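/- Let $n\ge 0$, identify $\mathbb{R}^n$ with the hyperplane $H=\{(x,z)\in\mathbb{R}^n\times\mathbb{R}: z=0\}$ of $\mathbb{R}^{n+1}$, and let $\mathbb{R}^{n+1}$ carry the Euclidean metric $\overline g=dx^2+dz^2$. A set $K\subset\mathbb{R}^n$ is a billiard table if it is the closure of a connected open subset of $\mathbb{R}^n$ and its boundary is of class $C^2$, i.e. for every $x_0\in\partial K$ there are a bounded open neighborhood $U$ of $x_0$ in $\mathbb{R}^n$ and a function $f\in C^2(\overline U)$ for which $0$ is a regular value on $U$ (that is, $Df(x)\neq 0$ whenever $x\in U$ and $f(x)=0$) such that $$K\cap U=\{x\in U: f(x)\ge 0\},\qquad \partial K\cap U=\{x\in U: f(x)=0\}.\qquad (*)$$ Let $K\subset\mathbb{R}^n$ be a billiard table that is a convex set, and let $p_0\in\partial K$. Then there exist a bounded open neighborhood $U\subset\mathbb{R}^n$ of $p_0$ and a function $f\in C^2(\overline U)$ with regular value $0$ on $U$ satisfying $(*)$ such that, for every $\lambda\in(0,1)$, the fold $$M_\lambda^{p_0}=\{(x,z)\in U\times\mathbb{R}: z^2=\lambda^2 f(x)\}\subset\mathbb{R}^{n+1}$$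 is an embedded hypersurface of class $C^2$ and all sectional curvatures of $M_\lambda^{p_0}$, with the Riemannian metric $g_\lambda$ induced by $\overline g$, are nonnegative at every point. Here the components of $g_\lambda$ in a $C^2$ parametrization are of class $C^1$, and its curvature tensor is the continuous tensor given by the usual formula $$R_{ijkl}=\partial_i\Gamma_{jk,l}-\partial_j\Gamma_{ik,l}-\sum_p\left(\Gamma^p_{jk}\Gamma_{il,p}-\Gamma^p_{ik}\Gamma_{jl,p}\right),$$ in which the derivatives of the Christoffel symbols $\Gamma_{jk,l}=\tfrac12(\partial_j g_{kl}+\partial_k g_{jl}-\partial_l g_{jk})$ (with $\Gamma^p_{jk}=\sum_l g^{pl}\Gamma_{jk,l}$) are taken in the sense of distributions; the existence of this continuous tensor is part of the claim. The sectional curvature of the plane spanned by linearly independent $v,w$ is $R(v,w,w,v)/\left(g(v,v)g(w,w)-g(v,w)^2\right)$. -/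

import Mathlib

open MeasureTheory
open scoped ContDiff

noncomputable section

namespace FoldBilliard

/-- Euclidean space `ℝⁿ`, identified with the hyperplane `H = {(x, z) : z = 0}` of `ℝⁿ⁺¹`
through `x ↦ (x, 0)`. -/
abbrev Plane (n : ℕ) : Type := EuclideanSpace ℝ (Fin n)

/-- Euclidean space `ℝⁿ⁺¹ = ℝⁿ × ℝ` with the metric `dx² + dz²`. -/
abbrev Ambient (n : ℕ) : Type := WithLp 2 (EuclideanSpace ℝ (Fin n) × ℝ)

/-! ### Billiard tables and folds -/

/-- `f ∈ C²(closure U)` has `0` as a regular value and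
`K ∩ U = {x ∈ U : f x ≥ 0}`, `∂K ∩ U = {x ∈ U : f x = 0}`. -/
structure IsDefiningFunction {n : ℕ} (K U : Set (Plane n)) (f : Plane n → ℝ) : Prop where
  contDiffOn : ContDiffOn ℝ 2 f (closure U)
  regular : ∀ x ∈ U, f x = 0 → fderiv ℝ f x ≠ 0
  table : K ∩ U = {x ∈ U | 0 ≤ f x}
  boundary : frontier K ∩ U = {x ∈ U | f x = 0}

/-- The boundary of the closed set `K` is of class `C²`. -/
def HasC2Boundary {n : ℕ} (K : Set (Plane n)) : Prop :=
  ∀ x₀ ∈ frontier K, ∃ (U : Set (Plane n)) (f : Plane n → ℝ),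
    IsOpen U ∧ Bornology.IsBounded U ∧ x₀ ∈ U ∧ IsDefiningFunction K U f

/-- A (Euclidean) billiard table: the closure of a connected open subset of `ℝⁿ`, with boundary
of class `C²`. It need not be bounded. -/
structure IsBilliardTable {n : ℕ} (K : Set (Plane n)) : Prop where
  eq_closure : ∃ Ω : Set (Plane n), IsOpen Ω ∧ IsConnected Ω ∧ K = closure Ω
  boundary : HasC2Boundary K

/-- The fold `{(x, z) ∈ U × ℝ : z² = lam² f(x)}`. -/
def fold {n : ℕ} (U : Set (Plane n)) (f : Plane n → ℝ) (lam : ℝ) : Set (Ambient n) :=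
  {q | q.fst ∈ U ∧ q.snd ^ 2 = lam ^ 2 * f q.fst}

/-! ### Hypersurfaces of class `C²` and their induced metric -/

/-- `φ : V → M` is a local `C²` parametrization of `M ⊆ ℝⁿ⁺¹`: a `C²` immersion of the open set
`V ⊆ ℝⁿ` which is a homeomorphism onto a relatively open subset of `M`. -/
structure IsLocalParametrization {n : ℕ} (M : Set (Ambient n)) (V : Set (Plane n))
    (φ : Plane n → Ambient n) : Prop where
  isOpen : IsOpen V
  contDiffOn : ContDiffOn ℝ 2 φ V
  immersion : ∀ x ∈ V, Function.Injective (fderiv ℝ φ x)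
  isEmbedding : Topology.IsEmbedding (fun x : V => φ x)
  image : ∃ W : Set (Ambient n), IsOpen W ∧ φ '' V = M ∩ W

/-- `M` is an (embedded) hypersurface of `ℝⁿ⁺¹` of class `C²`. -/
def IsC2Hypersurface {n : ℕ} (M : Set (Ambient n)) : Prop :=
  ∀ q ∈ M, ∃ (V : Set (Plane n)) (φ : Plane n → Ambient n),
    IsLocalParametrization M V φ ∧ q ∈ φ '' V

/-- The partial derivative `∂ᵢ h (x)`. -/
def partialDeriv {n : ℕ} (i : Fin n) (h : Plane n → ℝ) (x : Plane n) : ℝ :=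
  fderiv ℝ h x (EuclideanSpace.single i 1)

/-- The components `g_ij = ⟨∂ᵢφ, ∂ⱼφ⟩` of the metric induced by the Euclidean metric, in the
local parametrization `φ`. -/
def inducedMetric {n : ℕ} (φ : Plane n → Ambient n) (x : Plane n) : Matrix (Fin n) (Fin n) ℝ :=
  Matrix.of fun i j =>
    inner ℝ (fderiv ℝ φ x (EuclideanSpace.single i 1)) (fderiv ℝ φ x (EuclideanSpace.single j 1))

/-! ### Curvature of a Riemannian metric in coordinates -/

/-- Christoffel symbols of the first kind,
`Γ_{ij,k} = (∂ᵢ g_jk + ∂ⱼ g_ik - ∂ₖ g_ij) / 2 = g(∇ᵢ∂ⱼ, ∂ₖ)`. -/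
def christoffelFirst {n : ℕ} (g : Plane n → Matrix (Fin n) (Fin n) ℝ) (i j k : Fin n)
    (x : Plane n) : ℝ :=
  (partialDeriv i (fun y => g y j k) x + partialDeriv j (fun y => g y i k) x
    - partialDeriv k (fun y => g y i j) x) / 2

/-- Christoffel symbols of the second kind, `Γ^p_ij = ∑ₖ g^{pk} Γ_{ij,k}`. -/
def christoffelSecond {n : ℕ} (g : Plane n → Matrix (Fin n) (Fin n) ℝ) (p i j : Fin n)
    (x : Plane n) : ℝ :=
  ∑ k, (g x)⁻¹ p k * christoffelFirst g i j k x

/-- `R_ijkl = g(R(∂ᵢ,∂ⱼ)∂ₖ, ∂ₗ)` is the (continuous) Riemann curvature tensor on `V` of the metric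
`g`, that is
`R_ijkl = ∂ᵢ Γ_{jk,l} - ∂ⱼ Γ_{ik,l} - ∑ₚ (Γ^p_jk Γ_{il,p} - Γ^p_ik Γ_{jl,p})`.
On a hypersurface of class `C²` the components of the induced metric are in general only `C¹`, so
the two outer derivatives are taken in the sense of distributions. A continuous `R` with this
property is unique on `V`, and for metrics of class `C²` it is the usual curvature tensor. -/
structure IsCurvatureTensor {n : ℕ} (g : Plane n → Matrix (Fin n) (Fin n) ℝ) (V : Set (Plane n))
    (R : Fin n → Fin n → Fin n → Fin n → Plane n → ℝ) : Prop where
  continuousOn : ∀ i j k l, ContinuousOn (R i j k l) V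
  weak_eq : ∀ i j k l, ∀ η : Plane n → ℝ, ContDiff ℝ ∞ η → HasCompactSupport η → tsupport η ⊆ V →
    ∫ x, R i j k l x * η x =
      ∫ x, (- (christoffelFirst g j k l x * partialDeriv i η x)
        + christoffelFirst g i k l x * partialDeriv j η x
        - (∑ p, (christoffelSecond g p j k x * christoffelFirst g i l p x
            - christoffelSecond g p i k x * christoffelFirst g j l p x)) * η x)

/-- The scalar product `g_x(v, w)`. -/
def metricPairing {n : ℕ} (g : Plane n → Matrix (Fin n) (Fin n) ℝ) (x v w : Plane n) : ℝ :=
  ∑ i, ∑ j, g x i j * v i * w j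

/-- The sectional curvature at `x` of the plane spanned by `v` and `w`,
`R(v,w,w,v) / (g(v,v) g(w,w) - g(v,w)²)`, for the metric `g` with curvature tensor `R`. -/
def sectionalCurvature {n : ℕ} (g : Plane n → Matrix (Fin n) (Fin n) ℝ)
    (R : Fin n → Fin n → Fin n → Fin n → Plane n → ℝ) (x v w : Plane n) : ℝ :=
  (∑ i, ∑ j, ∑ k, ∑ l, R i j k l x * v i * w j * w k * v l) /
    (metricPairing g x v v * metricPairing g x w w - metricPairing g x v w ^ 2)

/-- The hypersurface `M`, with the metric induced by the Euclidean one, has a curvature tensor and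
all its sectional curvatures, at every point and for every tangent plane, are at least `κ`
(computed in any local parametrization of `M`). -/
def SectionalCurvatureGE {n : ℕ} (M : Set (Ambient n)) (κ : ℝ) : Prop :=
  ∀ (V : Set (Plane n)) (φ : Plane n → Ambient n), IsLocalParametrization M V φ →
    ∃ R : Fin n → Fin n → Fin n → Fin n → Plane n → ℝ,
      IsCurvatureTensor (inducedMetric φ) V R ∧
      ∀ x ∈ V, ∀ v w : Plane n, LinearIndependent ℝ ![v, w] →
        κ ≤ sectionalCurvature (inducedMetric φ) R x v w

end FoldBilliard

end

open MeasureTheory Filter Topology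
open scoped ContDiff

noncomputable section

namespace FoldBilliard

/-! ### Cutoffs and integration by parts for `C¹` functions. -/

section

/-! A given defining function `f₀` of a convex table need not be concave. By the implicit function
theorem it can be replaced near `p₀` by the height `f` above the boundary, measured along a unit
vector `e` with `Df₀(p₀) e > 0` (`exists_graph_function`). This `f` has the same sign as `f₀`,
satisfies `f (x + t • e) = f x + t`, and is concave near `p₀` because `K` is convex
(`eventually_concaveOn_ball`). The region `z² ≤ lam² f(x)` over a ball is then convex, so the fold
lies on one side of each of its tangent hyperplanes. Its second fundamental form is therefore
semidefinite, and the Gauss equation gives nonnegative sectional curvature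
(`sectionalCurvatureGE_zero_of_support`).

The fold is only `C²`, so the Gauss equation has to be proved weakly
(`isCurvatureTensor_gaussTensor`). Third derivatives of the parametrization are avoided through `∫
⟨∂ₐu, ∂_b w⟩ = ∫ ⟨∂_b u, ∂ₐw⟩` for `C¹` maps, applied to `u = ∂_c φ` and `w = η ∂_d φ`. The
remaining terms are identified through the inverse Gram matrix, which computes scalar products of
tangential parts. -/

theorem contDiff_of_contDiffAt_tsupport {E F : Type*} [NormedAddCommGroup E] [NormedSpace ℝ E]
    [NormedAddCommGroup F] [NormedSpace ℝ F] {k : WithTop ℕ∞} {u : E → F} (hu : ∀ x ∈ tsupport u, ContDiffAt ℝ k u x) :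
    ContDiff ℝ k u := by
  refine contDiff_iff_contDiffAt.2 fun x => ?_
  by_cases hx : x ∈ tsupport u
  · exact hu x hx
  · exact (contDiffAt_const (c := 0)).congr_of_eventuallyEq (notMem_tsupport_iff_eventuallyEq.1 hx)

variable {E : Type*} [NormedAddCommGroup E] [NormedSpace ℝ E] [FiniteDimensional ℝ E]

/-- A function that is `C^k` on an open set agrees, near any compact subset, with a compactly
supported `C^k` function. -/
theorem exists_contDiff_eventuallyEq_of_isCompact {F : Type*} [NormedAddCommGroup F]
    [NormedSpace ℝ F] {k : ℕ} {V T : Set E} (hV : IsOpen V) (hT : IsCompact T) (hTV : T ⊆ V)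
    {u : E → F} (hu : ContDiffOn ℝ k u V) :
    ∃ u' : E → F, ContDiff ℝ k u' ∧ HasCompactSupport u' ∧ ∀ x ∈ T, u' =ᶠ[𝓝 x] u := by
  obtain ⟨S, hS, hTS, hSV⟩ := exists_compact_between hT hV hTV
  obtain ⟨χ, h1, h0, -⟩ := exists_contMDiffMap_one_nhds_of_subset_interior
    (modelWithCornersSelf ℝ E) (n := (k : ℕ∞)) hT.isClosed hTS
  have hχ : ContDiff ℝ k χ := χ.contMDiff.contDiff
  have hsupp : tsupport (fun x => χ x • u x) ⊆ S := by
    refine closure_minimal (fun x hx => ?_) hS.isClosed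
    by_contra hxS
    exact hx (by simp [h0 x hxS])
  refine ⟨fun x => χ x • u x, ?_, hS.of_isClosed_subset (isClosed_tsupport _) hsupp, ?_⟩
  · refine contDiff_of_contDiffAt_tsupport fun x hx => ?_
    exact hχ.contDiffAt.smul (hu.contDiffAt (hV.mem_nhds (hSV (hsupp hx))))
  · intro x hx
    filter_upwards [mem_nhdsSet_iff_forall.1 h1 x hx] with y hy
    simp [show χ y = 1 from hy]

variable [MeasurableSpace E] [BorelSpace E]

/-- For compactly supported `C¹` functions, `∫ ∂ₐu ∂_b w = ∫ ∂_b u ∂ₐw`. -/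
theorem integral_fderiv_mul_fderiv_comm (μ : Measure E) [μ.IsAddHaarMeasure] {u w : E → ℝ}
    (hu : ContDiff ℝ 1 u) (hu' : HasCompactSupport u)
    (hw : ContDiff ℝ 1 w) (hw' : HasCompactSupport w) (a b : E) :
    ∫ x, fderiv ℝ u x a * fderiv ℝ w x b ∂μ = ∫ x, fderiv ℝ u x b * fderiv ℝ w x a ∂μ := by
  obtain ⟨C, hC⟩ := hu.lipschitzWith_of_hasCompactSupport hu' one_ne_zero
  obtain ⟨D, hD⟩ := hw.lipschitzWith_of_hasCompactSupport hw' one_ne_zero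
  have du : Differentiable ℝ u := hu.differentiable one_ne_zero
  have dw : Differentiable ℝ w := hw.differentiable one_ne_zero
  have lu : ∀ x v, lineDeriv ℝ u x v = fderiv ℝ u x v := fun x v => (du x).lineDeriv_eq_fderiv
  have lw : ∀ x v, lineDeriv ℝ w x v = fderiv ℝ w x v := fun x v => (dw x).lineDeriv_eq_fderiv
  have cu : Continuous fun x => fderiv ℝ u x a := (hu.continuous_fderiv one_ne_zero).clm_apply
    continuous_const
  have cw : Continuous fun x => fderiv ℝ w x a := (hw.continuous_fderiv one_ne_zero).clm_apply
    continuous_const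
  have iu : Integrable (fun x => fderiv ℝ u x a) μ :=
    cu.integrable_of_hasCompactSupport (hu'.fderiv_apply ℝ a)
  have iw : Integrable (fun x => fderiv ℝ w x a) μ :=
    cw.integrable_of_hasCompactSupport (hw'.fderiv_apply ℝ a)
  have T1 := hD.integral_inv_smul_sub_mul_tendsto_integral_lineDeriv_mul iu b
  have T2 := (hC.integral_inv_smul_sub_mul_tendsto_integral_lineDeriv_mul iw (-b)).neg
  -- Second derivatives are unavailable, so `∂_b` is replaced by a difference quotient. That
  -- quotient is still `C¹`, so `∂ₐ` can be moved off `u`; translation invariance then moves the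
  -- quotient onto `u`, with step `-b`. The identity follows as `t → 0⁺`.
  have key : ∀ t : ℝ, ∫ x, (t⁻¹ • (w (x + t • b) - w x)) * fderiv ℝ u x a ∂μ =
      - ∫ x, (t⁻¹ • (u (x + t • (-b)) - u x)) * fderiv ℝ w x a ∂μ := by
    intro t
    set W : E → ℝ := fun x => t⁻¹ • (w (x + t • b) - w x) with hW
    have hWs : HasCompactSupport W := by
      have h1 : HasCompactSupport fun x => w (x + t • b) :=
        hw'.comp_homeomorph (Homeomorph.addRight (t • b))
      exact HasCompactSupport.mul_left (f := fun _ => t⁻¹) (h1.sub hw')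
    have hWc : ContDiff ℝ 1 W := by
      have : ContDiff ℝ 1 fun x => w (x + t • b) := hw.comp (by fun_prop)
      exact (this.sub hw).const_smul t⁻¹
    obtain ⟨D', hD'⟩ := hWc.lipschitzWith_of_hasCompactSupport hWs one_ne_zero
    have e1 := hC.integral_lineDeriv_mul_eq (μ := μ) hD' hWs a
    have dW : ∀ x, lineDeriv ℝ W x (-a) =
        -(t⁻¹ * (fderiv ℝ w (x + t • b) a - fderiv ℝ w x a)) := by
      intro x
      have h1 : HasFDerivAt (fun x => w (x + t • b)) (fderiv ℝ w (x + t • b)) x :=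
        (hasFDerivAt_comp_add_right (t • b)).2 (dw _).hasFDerivAt
      have h2 : HasFDerivAt W (t⁻¹ • (fderiv ℝ w (x + t • b) - fderiv ℝ w x)) x :=
        (h1.sub (dw x).hasFDerivAt).const_smul t⁻¹
      rw [h2.differentiableAt.lineDeriv_eq_fderiv, h2.fderiv]
      simp only [smul_apply, sub_apply, smul_eq_mul, map_neg]
    have i1 : Integrable (fun x => fderiv ℝ w x a * u x) μ :=
      (cw.mul hu.continuous).integrable_of_hasCompactSupport (hw'.fderiv_apply ℝ a).mul_right
    have i2 : Integrable (fun x => fderiv ℝ w (x + t • b) a * u x) μ :=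
      ((cw.comp (by fun_prop : Continuous fun x : E => x + t • b)).mul
        hu.continuous).integrable_of_hasCompactSupport hu'.mul_left
    have i3 : Integrable (fun x => fderiv ℝ w x a * u (x + t • -b)) μ :=
      (cw.mul (hu.continuous.comp
        (by fun_prop : Continuous fun x : E => x + t • -b))).integrable_of_hasCompactSupport
        (hw'.fderiv_apply ℝ a).mul_right
    have shift : ∫ x, fderiv ℝ w (x + t • b) a * u x ∂μ =
        ∫ x, fderiv ℝ w x a * u (x + t • -b) ∂μ := by
      rw [← integral_add_right_eq_self (fun x => fderiv ℝ w x a * u (x + t • -b)) (t • b)]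
      simp
    calc ∫ x, W x * fderiv ℝ u x a ∂μ = ∫ x, lineDeriv ℝ u x a * W x ∂μ := by
          simp only [lu, mul_comm]
      _ = ∫ x, -(t⁻¹ * (fderiv ℝ w (x + t • b) a * u x - fderiv ℝ w x a * u x)) ∂μ := by
          rw [e1]; congr 1; ext x; rw [dW]; ring
      _ = -(t⁻¹ * (∫ x, fderiv ℝ w x a * u (x + t • -b) ∂μ - ∫ x, fderiv ℝ w x a * u x ∂μ)) := by
          rw [integral_neg, integral_const_mul, integral_sub i2 i1, shift]
      _ = _ := by
          rw [← integral_sub i3 i1, ← integral_const_mul]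
          congr 2; ext x; simp only [smul_eq_mul]; ring
  simp only [key] at T1
  have := tendsto_nhds_unique T1 T2
  simp only [lu, lw, map_neg, neg_mul, integral_neg, neg_neg] at this
  rw [← this]
  simp only [mul_comm]

/-- If `u` is `C¹` on the open set `V` and `w` is `C¹` with compact support in `V`, then
`∫ ⟨∂ₐu, ∂_b w⟩ = ∫ ⟨∂_b u, ∂ₐw⟩`. -/
theorem integrable_inner_fderiv_fderiv {F : Type*} [NormedAddCommGroup F]
    [InnerProductSpace ℝ F] (μ : Measure E) [μ.IsAddHaarMeasure]
    {V : Set E} (hV : IsOpen V) {u w : E → F} (hu : ContDiffOn ℝ 1 u V) (hw : ContDiff ℝ 1 w)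
    (hw' : HasCompactSupport w) (hwV : tsupport w ⊆ V) (a b : E) :
    Integrable (fun x => inner ℝ (fderiv ℝ u x a) (fderiv ℝ w x b)) μ := by
  obtain ⟨u', hu1, hu2, hu3⟩ := exists_contDiff_eventuallyEq_of_isCompact hV hw' hwV (k := 1)
    (by exact_mod_cast hu)
  have : (fun x => inner ℝ (fderiv ℝ u x a) (fderiv ℝ w x b)) =
      fun x => inner ℝ (fderiv ℝ u' x a) (fderiv ℝ w x b) := by
    ext x
    by_cases hx : x ∈ tsupport w
    · rw [(hu3 x hx).fderiv_eq]
    · have : fderiv ℝ w x = 0 := image_eq_zero_of_notMem_tsupport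
        (fun h => hx (tsupport_fderiv_subset ℝ h))
      simp [this]
  rw [this]
  refine Continuous.integrable_of_hasCompactSupport ?_ ?_
  · exact ((hu1.continuous_fderiv (by simp)).clm_apply continuous_const).inner
      ((hw.continuous_fderiv one_ne_zero).clm_apply continuous_const)
  · exact (hw'.fderiv_apply ℝ b).mono fun x hx h => hx (by simp [h])

/-- Only the values of `u` near `tsupport w` matter, so `u` may be taken compactly supported; the
scalar identity then applies to each coordinate in an orthonormal basis of `F`. -/
theorem integral_inner_fderiv_fderiv_comm {F : Type*} [NormedAddCommGroup F]
    [InnerProductSpace ℝ F] [FiniteDimensional ℝ F] (μ : Measure E) [μ.IsAddHaarMeasure]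
    {V : Set E} (hV : IsOpen V) {u w : E → F} (hu : ContDiffOn ℝ 1 u V) (hw : ContDiff ℝ 1 w)
    (hw' : HasCompactSupport w) (hwV : tsupport w ⊆ V) (a b : E) :
    ∫ x, inner ℝ (fderiv ℝ u x a) (fderiv ℝ w x b) ∂μ =
      ∫ x, inner ℝ (fderiv ℝ u x b) (fderiv ℝ w x a) ∂μ := by
  obtain ⟨u', hu1, hu2, hu3⟩ := exists_contDiff_eventuallyEq_of_isCompact hV hw' hwV (k := 1)
    (by exact_mod_cast hu)
  have hu1' : ContDiff ℝ 1 u' := by exact_mod_cast hu1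
  have repl : ∀ a b, (fun x => inner ℝ (fderiv ℝ u x a) (fderiv ℝ w x b)) =
      fun x => inner ℝ (fderiv ℝ u' x a) (fderiv ℝ w x b) := by
    intro a b
    ext x
    by_cases hx : x ∈ tsupport w
    · rw [(hu3 x hx).fderiv_eq]
    · have : fderiv ℝ w x = 0 := image_eq_zero_of_notMem_tsupport
        (fun h => hx (tsupport_fderiv_subset ℝ h))
      simp [this]
  rw [repl, repl]
  let B := stdOrthonormalBasis ℝ F
  let c : Fin (Module.finrank ℝ F) → F →L[ℝ] ℝ := fun m => innerSL ℝ (B m)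
  have hc : ∀ (m) {v : E → F}, ContDiff ℝ 1 v → ContDiff ℝ 1 (c m ∘ v) :=
    fun m v hv => (c m).contDiff.comp hv
  have hcs : ∀ (m) {v : E → F}, HasCompactSupport v → HasCompactSupport (c m ∘ v) :=
    fun m v hv => hv.comp_left (map_zero _)
  have expand : ∀ a b, (fun x => inner ℝ (fderiv ℝ u' x a) (fderiv ℝ w x b)) =
      fun x => ∑ m, fderiv ℝ (c m ∘ u') x a * fderiv ℝ (c m ∘ w) x b := by
    intro a b
    ext x
    rw [← B.sum_inner_mul_inner]
    refine Finset.sum_congr rfl fun m _ => ?_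
    rw [((c m).hasFDerivAt.comp x (hu1'.differentiable one_ne_zero x).hasFDerivAt).fderiv,
      ((c m).hasFDerivAt.comp x (hw.differentiable one_ne_zero x).hasFDerivAt).fderiv]
    simp [c, real_inner_comm]
  have hint : ∀ m a b, Integrable (fun x => fderiv ℝ (c m ∘ u') x a * fderiv ℝ (c m ∘ w) x b) μ :=
    fun m a b => Continuous.integrable_of_hasCompactSupport
      ((((hc m hu1').continuous_fderiv one_ne_zero).clm_apply continuous_const).mul
        (((hc m hw).continuous_fderiv one_ne_zero).clm_apply continuous_const))
      ((hcs m hw').fderiv_apply ℝ b).mul_left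
  rw [expand, expand, integral_finsetSum _ fun m _ => hint m a b,
    integral_finsetSum _ fun m _ => hint m b a]
  exact Finset.sum_congr rfl fun m _ => integral_fderiv_mul_fderiv_comm μ (hc m hu1') (hcs m hu2)
    (hc m hw) (hcs m hw') a b

end

/-! ### Second order conditions at a maximum. -/

section SecondOrder

variable {E F : Type*} [NormedAddCommGroup E] [NormedSpace ℝ E]
  [NormedAddCommGroup F] [InnerProductSpace ℝ F]

/-- First and second order necessary conditions for a local maximum of `y ↦ ⟨ν, φ y⟩`. -/
theorem inner_fderiv_eq_zero_and_inner_fderiv_fderiv_nonpos {φ : E → F} {x : E} {ν : F}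
    (hφ : ContDiffAt ℝ 2 φ x) (hmax : IsLocalMax (fun y => inner ℝ ν (φ y)) x) (v : E) :
    inner ℝ ν (fderiv ℝ φ x v) = 0 ∧ inner ℝ ν (fderiv ℝ (fderiv ℝ φ) x v v) ≤ 0 := by
  have hline : ∀ t : ℝ, HasDerivAt (fun t : ℝ => x + t • v) v t := fun t => by
    simpa using ((hasDerivAt_id t).smul_const v).const_add x
  have hcont : Tendsto (fun t : ℝ => x + t • v) (𝓝 0) (𝓝 x) := by
    have : ContinuousAt (fun t : ℝ => x + t • v) 0 := (hline 0).continuousAt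
    simpa [ContinuousAt] using this
  have hd : ∀ᶠ y in 𝓝 x, DifferentiableAt ℝ φ y := by
    filter_upwards [hφ.eventually (by simp)] with y hy using hy.differentiableAt (by simp)
  set g : ℝ → ℝ := fun t => inner ℝ ν (φ (x + t • v)) with hg
  have hg' : ∀ᶠ t in 𝓝 (0 : ℝ), HasDerivAt g (inner ℝ ν (fderiv ℝ φ (x + t • v) v)) t := by
    filter_upwards [hcont.eventually hd] with t ht
    have := (hasDerivAt_const t ν).inner ℝ (ht.hasFDerivAt.comp_hasDerivAt t (hline t))
    simpa using this
  have hmax0 : IsLocalMax g 0 := by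
    have := hcont.eventually hmax
    simpa [IsLocalMax, IsMaxFilter, hg] using this
  have hder : deriv g =ᶠ[𝓝 0] fun t => inner ℝ ν (fderiv ℝ φ (x + t • v) v) := by
    filter_upwards [hg'] with t ht using ht.deriv
  have h2 : HasFDerivAt (fderiv ℝ φ) (fderiv ℝ (fderiv ℝ φ) x) (x + (0 : ℝ) • v) := by
    simpa using ((hφ.fderiv_right (m := 1) (by norm_num)).differentiableAt (by simp)).hasFDerivAt
  have hgg : HasDerivAt (deriv g) (inner ℝ ν (fderiv ℝ (fderiv ℝ φ) x v v)) 0 := by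
    refine HasDerivAt.congr_of_eventuallyEq ?_ hder
    have h4 : HasDerivAt (fun t : ℝ => fderiv ℝ φ (x + t • v)) (fderiv ℝ (fderiv ℝ φ) x v) 0 :=
      h2.comp_hasDerivAt (0 : ℝ) (hline 0)
    have h3 : HasDerivAt (fun t : ℝ => fderiv ℝ φ (x + t • v) v)
        (fderiv ℝ (fderiv ℝ φ) x v v) 0 := by
      simpa using h4.clm_apply (hasDerivAt_const (0 : ℝ) v)
    simpa using (hasDerivAt_const (0 : ℝ) ν).inner ℝ h3
  have h0 : deriv g 0 = 0 := hmax0.deriv_eq_zero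
  refine ⟨by simpa [h0] using hder.self_of_nhds.symm, ?_⟩
  by_contra! hpos
  -- A positive second derivative would make the maximum also a local minimum, so `g` would be
  -- locally constant and its second derivative zero.
  have hmin := isLocalMin_of_deriv_deriv_pos (by rwa [hgg.deriv]) h0 hg'.self_of_nhds.continuousAt
  have hconst : g =ᶠ[𝓝 0] fun _ => g 0 := by
    filter_upwards [hmin, hmax0] with t h1 h2 using le_antisymm h2 h1
  have : deriv (deriv g) 0 = 0 := by
    rw [(hconst.deriv).deriv_eq]
    simp
  rw [hgg.deriv] at this
  exact hpos.ne' this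

end SecondOrder

/-! ### Inverse Gram matrices and tangential parts. -/

section Gram

variable {F : Type*} [NormedAddCommGroup F] [InnerProductSpace ℝ F]

/-- If `c = ∑ rᵢ eᵢ`, the vector of the `⟨c, e_q⟩` is the Gram matrix applied to `r`, so its inverse
recovers the coefficients `r`. -/
theorem sum_inv_gram_mul_inner_of_mem_span {ι : Type*} [Fintype ι] [DecidableEq ι] {e : ι → F}
    (he : LinearIndependent ℝ e) {c : F} (hc : c ∈ Submodule.span ℝ (Set.range e)) (b : F) :
    ∑ p, (∑ q, (Matrix.gram ℝ e)⁻¹ p q * inner ℝ c (e q)) * inner ℝ b (e p) = inner ℝ c b := by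
  obtain ⟨r, rfl⟩ := (Submodule.mem_span_range_iff_exists_fun ℝ).1 hc
  have hdet : IsUnit (Matrix.gram ℝ e).det :=
    isUnit_iff_ne_zero.2 (Matrix.det_gram_ne_zero_iff_linearIndependent.2 he)
  have h1 : (fun q => inner ℝ (∑ i, r i • e i) (e q)) = (Matrix.gram ℝ e).mulVec r := by
    ext q
    simp only [sum_inner, inner_smul_left, Matrix.mulVec, dotProduct, Matrix.gram_apply]
    exact Finset.sum_congr rfl fun i _ => by simp [real_inner_comm, mul_comm]
  have h2 : ∀ p, ∑ q, (Matrix.gram ℝ e)⁻¹ p q * inner ℝ (∑ i, r i • e i) (e q) = r p := by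
    intro p
    have : (Matrix.gram ℝ e)⁻¹.mulVec ((Matrix.gram ℝ e).mulVec r) p = r p := by
      rw [Matrix.mulVec_mulVec, Matrix.nonsing_inv_mul _ hdet, Matrix.one_mulVec]
    rw [← this, ← h1]
    rfl
  simp only [h2]
  simp only [sum_inner, inner_smul_left]
  exact Finset.sum_congr rfl fun i _ => by simp [real_inner_comm]

/-- If `e` is a linearly independent family spanning the hyperplane orthogonal to the unit vector
`ν`, then the scalar product of the tangential parts of `a` and `b` is expressed by the inverse
Gram matrix of `e`. -/
theorem sum_inv_gram_mul_inner {n : ℕ} [FiniteDimensional ℝ F]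
    (hF : Module.finrank ℝ F = n + 1) {e : Fin n → F}
    (he : LinearIndependent ℝ e) {ν : F} (hν : ‖ν‖ = 1) (hort : ∀ p, inner ℝ ν (e p) = 0)
    (a b : F) :
    ∑ p, (∑ q, (Matrix.gram ℝ e)⁻¹ p q * inner ℝ a (e q)) * inner ℝ b (e p) =
      inner ℝ a b - inner ℝ ν a * inner ℝ ν b := by
  have hspan : Submodule.span ℝ (Set.range e) = (Submodule.span ℝ {ν})ᗮ := by
    refine Submodule.eq_of_le_of_finrank_eq ?_ ?_
    · rw [Submodule.span_le]
      rintro _ ⟨p, rfl⟩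
      exact Submodule.mem_orthogonal_singleton_iff_inner_right.2 (hort p)
    · have h1 := (Submodule.span ℝ {ν}).finrank_add_finrank_orthogonal
      rw [finrank_span_singleton (by rintro rfl; simp at hν), hF] at h1
      rw [finrank_span_eq_card he, Fintype.card_fin]
      omega
  -- The left side depends on `a` only through the `⟨a, e_q⟩`, so removing the normal component of
  -- `a` leaves it unchanged.
  have hmem : a - inner ℝ ν a • ν ∈ Submodule.span ℝ (Set.range e) := by
    rw [hspan, Submodule.mem_orthogonal_singleton_iff_inner_right, inner_sub_right,
      inner_smul_right, real_inner_self_eq_norm_sq, hν]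
    ring
  have := sum_inv_gram_mul_inner_of_mem_span he hmem b
  simpa [inner_sub_left, inner_smul_left, hort] using this

end Gram

/-! ### The weak Gauss equation and the sign of the curvature. -/

section

section Generic

variable {E F : Type*} [NormedAddCommGroup E] [NormedSpace ℝ E]
  [NormedAddCommGroup F] [InnerProductSpace ℝ F] {φ : E → F} {x : E}

theorem hasFDerivAt_fderiv_apply (hφ : ContDiffAt ℝ 2 φ x) (a : E) :
    HasFDerivAt (fun y => fderiv ℝ φ y a) ((fderiv ℝ (fderiv ℝ φ) x).flip a) x := by
  have h := ((hφ.fderiv_right (m := 1) (by norm_num)).differentiableAt (by simp)).hasFDerivAt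
  simpa using h.clm_apply (hasFDerivAt_const a x)

theorem fderiv_inner_fderiv_apply (hφ : ContDiffAt ℝ 2 φ x) (a b c : E) :
    fderiv ℝ (fun y => (inner ℝ (fderiv ℝ φ y a) (fderiv ℝ φ y b) : ℝ)) x c =
      inner ℝ (fderiv ℝ (fderiv ℝ φ) x c a) (fderiv ℝ φ x b) +
        inner ℝ (fderiv ℝ φ x a) (fderiv ℝ (fderiv ℝ φ) x c b) := by
  have ha := hasFDerivAt_fderiv_apply hφ a
  have hb := hasFDerivAt_fderiv_apply hφ b
  rw [fderiv_inner_apply ℝ ha.differentiableAt hb.differentiableAt, ha.fderiv, hb.fderiv, add_comm]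
  rfl

/-- Weak form of `∂ₐ⟨∂_b∂_c φ, ∂_d φ⟩ - ∂_b⟨∂ₐ∂_c φ, ∂_d φ⟩ = ⟨∂_b∂_c φ, ∂ₐ∂_d φ⟩ - ⟨∂ₐ∂_c φ, ∂_b∂_d φ⟩`
for `φ` of class `C²`, with a term `R` split off. -/
theorem integral_mul_eq_integral_fderiv_fderiv [FiniteDimensional ℝ E] [MeasurableSpace E]
    [BorelSpace E] [FiniteDimensional ℝ F] (μ : Measure E) [μ.IsAddHaarMeasure] {V : Set E}
    (hV : IsOpen V) (hφ : ContDiffOn ℝ 2 φ V) {η R : E → ℝ} (hη : ContDiff ℝ 1 η)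
    (hηc : HasCompactSupport η) (hηV : tsupport η ⊆ V) (hR : Integrable (fun x => R x * η x) μ)
    (a b c d : E) :
    ∫ x, R x * η x ∂μ = ∫ x, (-(inner ℝ (fderiv ℝ (fderiv ℝ φ) x b c) (fderiv ℝ φ x d) *
        fderiv ℝ η x a) + inner ℝ (fderiv ℝ (fderiv ℝ φ) x a c) (fderiv ℝ φ x d) * fderiv ℝ η x b +
      (inner ℝ (fderiv ℝ (fderiv ℝ φ) x a c) (fderiv ℝ (fderiv ℝ φ) x b d) -
        inner ℝ (fderiv ℝ (fderiv ℝ φ) x b c) (fderiv ℝ (fderiv ℝ φ) x a d) + R x) * η x) ∂μ := by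
  have hat : ∀ x ∈ V, ContDiffAt ℝ 2 φ x := fun x hx => hφ.contDiffAt (hV.mem_nhds hx)
  have hu : ∀ c, ContDiffOn ℝ 1 (fun y => fderiv ℝ φ y c) V := fun c =>
    (hφ.fderiv_of_isOpen hV (by norm_num)).clm_apply contDiffOn_const
  set w : E → F := fun y => η y • fderiv ℝ φ y d with hw
  have hws : tsupport w ⊆ tsupport η := closure_mono fun y hy h => hy (by simp [hw, h])
  have hwc : HasCompactSupport w := hηc.of_isClosed_subset (isClosed_tsupport _) hws
  have hw1 : ContDiff ℝ 1 w := contDiff_of_contDiffAt_tsupport fun y hy =>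
    hη.contDiffAt.smul ((hu d).contDiffAt (hV.mem_nhds (hηV (hws hy))))
  have hwV := hws.trans hηV
  have I1 := integrable_inner_fderiv_fderiv μ hV (hu c) hw1 hwc hwV b a
  have I2 := integrable_inner_fderiv_fderiv μ hV (hu c) hw1 hwc hwV a b
  have I3 := integral_inner_fderiv_fderiv_comm μ hV (hu c) hw1 hwc hwV b a
  have hzero := integral_sub' I1 I2
  rw [I3, sub_self] at hzero
  -- The vanishing difference of the two integrals is subtracted; expanding the derivatives of `w =
  -- η ∂_d φ` by the product rule produces the terms on the right.
  rw [← sub_zero (∫ x, R x * η x ∂μ), ← hzero, ← integral_sub' hR (I1.sub I2)]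
  congr 1
  ext x
  by_cases hx : x ∈ tsupport η
  · have hxV := hηV hx
    have hwd : HasFDerivAt w (η x • (fderiv ℝ (fderiv ℝ φ) x).flip d +
        (fderiv ℝ η x).smulRight (fderiv ℝ φ x d)) x :=
      ((hη.differentiable (by simp)) x).hasFDerivAt.fun_smul
        (hasFDerivAt_fderiv_apply (hat x hxV) d)
    simp only [Pi.sub_apply, hwd.fderiv, (hasFDerivAt_fderiv_apply (hat x hxV) c).fderiv,
      ContinuousLinearMap.flip_apply, _root_.add_apply, _root_.smul_apply,
      ContinuousLinearMap.smulRight_apply, inner_add_right, inner_smul_right]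
    ring
  · have h1 : fderiv ℝ w x = 0 := fderiv_of_notMem_tsupport ℝ fun h => hx (hws h)
    have h2 : fderiv ℝ η x = 0 := fderiv_of_notMem_tsupport ℝ hx
    simp [image_eq_zero_of_notMem_tsupport hx, h1, h2]

end Generic

variable {n : ℕ}

/-- The second fundamental form of the parametrization `φ` with respect to `ν`. -/
def secondForm (φ ν : Plane n → Ambient n) (x v w : Plane n) : ℝ :=
  inner ℝ (ν x) (fderiv ℝ (fderiv ℝ φ) x v w)

/-- The coordinate vector fields `∂ᵢφ`. -/
def coordField (φ : Plane n → Ambient n) (x : Plane n) (i : Fin n) : Ambient n :=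
  fderiv ℝ φ x (EuclideanSpace.single i 1)

/-- The second derivatives `∂ᵢ∂ⱼφ`. -/
def coordHess (φ : Plane n → Ambient n) (x : Plane n) (i j : Fin n) : Ambient n :=
  fderiv ℝ (fderiv ℝ φ) x (EuclideanSpace.single i 1) (EuclideanSpace.single j 1)

theorem sum_smul_single (v : Plane n) : ∑ i, v i • EuclideanSpace.single i (1 : ℝ) = v := by
  ext j
  simp [Finset.sum_apply, Pi.single_apply]

theorem finrank_ambient : Module.finrank ℝ (Ambient n) = n + 1 := by
  rw [(WithLp.linearEquiv 2 ℝ (EuclideanSpace ℝ (Fin n) × ℝ)).finrank_eq]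
  simp

theorem inducedMetric_eq_gram (φ : Plane n → Ambient n) (x : Plane n) :
    inducedMetric φ x = Matrix.gram ℝ (coordField φ x) := by
  ext i j
  rfl

theorem metricPairing_inducedMetric (φ : Plane n → Ambient n) (x v w : Plane n) :
    metricPairing (inducedMetric φ) x v w = inner ℝ (fderiv ℝ φ x v) (fderiv ℝ φ x w) := by
  conv_rhs => rw [← sum_smul_single v, ← sum_smul_single w]
  simp only [map_sum, map_smul, sum_inner, inner_sum, inner_smul_left, inner_smul_right,
    Finset.mul_sum]
  rw [Finset.sum_comm]
  refine Finset.sum_congr rfl fun i _ => Finset.sum_congr rfl fun j _ => ?_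
  simp only [inducedMetric, Matrix.of_apply, conj_trivial]
  ring

theorem secondForm_eq_sum (φ ν : Plane n → Ambient n) (x v w : Plane n) :
    secondForm φ ν x v w = ∑ i, ∑ j, inner ℝ (ν x) (coordHess φ x i j) * v i * w j := by
  unfold secondForm coordHess
  conv_lhs => rw [← sum_smul_single v, ← sum_smul_single w]
  simp only [map_sum, map_smul, _root_.sum_apply, _root_.smul_apply, inner_sum, inner_smul_right,
    Finset.mul_sum]
  rw [Finset.sum_comm]
  refine Finset.sum_congr rfl fun i _ => Finset.sum_congr rfl fun j _ => ?_
  ring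

/-- The curvature tensor given by the Gauss equation. -/
def gaussTensor (φ ν : Plane n → Ambient n) (i j k l : Fin n) (x : Plane n) : ℝ :=
  inner ℝ (ν x) (coordHess φ x j k) * inner ℝ (ν x) (coordHess φ x i l) -
    inner ℝ (ν x) (coordHess φ x i k) * inner ℝ (ν x) (coordHess φ x j l)

theorem sum_gaussTensor (φ ν : Plane n → Ambient n) (x v w : Plane n) :
    ∑ i, ∑ j, ∑ k, ∑ l, gaussTensor φ ν i j k l x * v i * w j * w k * v l =
      secondForm φ ν x w w * secondForm φ ν x v v -
        secondForm φ ν x v w * secondForm φ ν x w v := by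
  simp only [secondForm_eq_sum, gaussTensor]
  generalize hh : (fun i j => inner ℝ (ν x) (coordHess φ x i j)) = h
  have hij : ∀ i j, inner ℝ (ν x) (coordHess φ x i j) = h i j := fun i j => by rw [← hh]
  simp only [hij, sub_mul, Finset.sum_sub_distrib]
  congr 1
  · have : ∀ i j k l, h j k * h i l * v i * w j * w k * v l =
        (h j k * w j * w k) * (h i l * v i * v l) := fun i j k l => by ring
    simp only [this, ← Finset.mul_sum, ← Finset.sum_mul]
  · have : ∀ i j k l, h i k * h j l * v i * w j * w k * v l =
        (h i k * v i * w k) * (h j l * w j * v l) := fun i j k l => by ring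
    simp only [this, ← Finset.mul_sum, ← Finset.sum_mul]

variable {φ ν : Plane n → Ambient n} {V : Set (Plane n)} {x : Plane n}

theorem coordHess_comm (hφ : ContDiffAt ℝ 2 φ x) (i j : Fin n) :
    coordHess φ x i j = coordHess φ x j i :=
  (hφ.isSymmSndFDerivAt (by simp)) _ _

theorem partialDeriv_inducedMetric (hφ : ContDiffAt ℝ 2 φ x) (i j k : Fin n) :
    partialDeriv i (fun y => inducedMetric φ y j k) x =
      inner ℝ (coordHess φ x i j) (coordField φ x k) +
        inner ℝ (coordField φ x j) (coordHess φ x i k) := by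
  exact fderiv_inner_fderiv_apply hφ _ _ _

theorem christoffelFirst_inducedMetric (hφ : ContDiffAt ℝ 2 φ x) (i j k : Fin n) :
    christoffelFirst (inducedMetric φ) i j k x =
      inner ℝ (coordHess φ x i j) (coordField φ x k) := by
  simp only [christoffelFirst, partialDeriv_inducedMetric hφ]
  rw [coordHess_comm hφ j i, coordHess_comm hφ k i, coordHess_comm hφ k j,
    real_inner_comm (coordHess φ x i k), real_inner_comm (coordHess φ x j k)]
  ring

/-- The contraction over `p` is the scalar product of the tangential parts of `∂ᵢ∂ⱼφ` and `∂ₖ∂ₗφ`.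
The missing normal parts are the products of second fundamental forms that make up `gaussTensor`. -/
theorem sum_christoffelSecond_mul_christoffelFirst (hφ : ContDiffAt ℝ 2 φ x)
    (himm : Function.Injective (fderiv ℝ φ x)) (hν : ‖ν x‖ = 1)
    (hort : ∀ v, inner ℝ (ν x) (fderiv ℝ φ x v) = 0) (i j k l : Fin n) :
    ∑ p, christoffelSecond (inducedMetric φ) p i j x *
        christoffelFirst (inducedMetric φ) k l p x =
      inner ℝ (coordHess φ x i j) (coordHess φ x k l) -
        inner ℝ (ν x) (coordHess φ x i j) * inner ℝ (ν x) (coordHess φ x k l) := by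
  have hli : LinearIndependent ℝ (coordField φ x) := by
    have h1 : LinearIndependent ℝ fun i : Fin n => (EuclideanSpace.single i 1 : Plane n) := by
      have := (EuclideanSpace.basisFun (Fin n) ℝ).orthonormal.linearIndependent
      rwa [show ⇑(EuclideanSpace.basisFun (Fin n) ℝ) = fun i => EuclideanSpace.single i 1 from
        funext fun i => EuclideanSpace.basisFun_apply (Fin n) ℝ i] at this
    exact h1.map' (fderiv ℝ φ x).toLinearMap (LinearMap.ker_eq_bot.2 himm)
  simp only [christoffelSecond, christoffelFirst_inducedMetric hφ, inducedMetric_eq_gram]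
  exact sum_inv_gram_mul_inner finrank_ambient hli hν (fun p => hort _) _ _

/-- The **Gauss equation** in its weak form, for a hypersurface of class `C²`. -/
theorem isCurvatureTensor_gaussTensor (hV : IsOpen V) (hφ : ContDiffOn ℝ 2 φ V)
    (himm : ∀ x ∈ V, Function.Injective (fderiv ℝ φ x)) (hνc : ContinuousOn ν V)
    (hν : ∀ x ∈ V, ‖ν x‖ = 1) (hort : ∀ x ∈ V, ∀ v, inner ℝ (ν x) (fderiv ℝ φ x v) = 0) :
    IsCurvatureTensor (inducedMetric φ) V (gaussTensor φ ν) := by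
  have hat : ∀ x ∈ V, ContDiffAt ℝ 2 φ x := fun x hx => hφ.contDiffAt (hV.mem_nhds hx)
  have hd1 : ContDiffOn ℝ 1 (fderiv ℝ φ) V := hφ.fderiv_of_isOpen hV (by norm_num)
  have hd2 : ContinuousOn (fderiv ℝ (fderiv ℝ φ)) V := hd1.continuousOn_fderiv_of_isOpen hV (by simp)
  have hHess : ∀ i j, ContinuousOn (fun x => inner ℝ (ν x) (coordHess φ x i j)) V := fun i j =>
    hνc.inner ((hd2.clm_apply continuousOn_const).clm_apply continuousOn_const)
  have hR : ∀ i j k l, ContinuousOn (gaussTensor φ ν i j k l) V := fun i j k l =>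
    ((hHess j k).mul (hHess i l)).sub ((hHess i k).mul (hHess j l))
  refine ⟨hR, fun i j k l η hη hηc hηV => ?_⟩
  have hRi : Integrable fun x => gaussTensor φ ν i j k l x * η x := by
    refine Continuous.integrable_of_hasCompactSupport ?_ hηc.mul_left
    refine continuous_of_tsupport fun y hy => ?_
    have hyV : y ∈ V := hηV (tsupport_mul_subset_right hy)
    exact ((hR i j k l).continuousAt (hV.mem_nhds hyV)).mul hη.continuous.continuousAt
  rw [integral_mul_eq_integral_fderiv_fderiv volume hV hφ (hη.of_le (by simp)) hηc hηV hRi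
    (EuclideanSpace.single i 1) (EuclideanSpace.single j 1) (EuclideanSpace.single k 1)
    (EuclideanSpace.single l 1)]
  congr 1
  ext x
  by_cases hx : x ∈ tsupport η
  · have hxV := hηV hx
    rw [Finset.sum_sub_distrib,
      sum_christoffelSecond_mul_christoffelFirst (hat x hxV) (himm x hxV) (hν x hxV) (hort x hxV),
      sum_christoffelSecond_mul_christoffelFirst (hat x hxV) (himm x hxV) (hν x hxV) (hort x hxV),
      christoffelFirst_inducedMetric (hat x hxV), christoffelFirst_inducedMetric (hat x hxV)]
    simp only [gaussTensor, partialDeriv, coordHess, coordField]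
    ring
  · have h2 : fderiv ℝ η x = 0 := fderiv_of_notMem_tsupport ℝ hx
    simp [image_eq_zero_of_notMem_tsupport hx, h2, partialDeriv]

/-- A set with a continuous field of outer unit normals, lying on one side of each of its tangent
hyperplanes, has nonnegative sectional curvatures. -/
theorem sectionalCurvatureGE_zero_of_support {M : Set (Ambient n)} {N : Ambient n → Ambient n}
    (hNc : ContinuousOn N M) (hN : ∀ q ∈ M, ‖N q‖ = 1)
    (hsupp : ∀ q ∈ M, ∀ q' ∈ M, inner ℝ (N q) (q' - q) ≤ 0) :
    SectionalCurvatureGE M 0 := by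
  intro V φ hφ
  obtain ⟨W, -, hW⟩ := hφ.image
  have hM : ∀ x ∈ V, φ x ∈ M := fun x hx => (hW ▸ Set.mem_image_of_mem φ hx : φ x ∈ M ∩ W).1
  set ν : Plane n → Ambient n := fun x => N (φ x) with hν
  have hat : ∀ x ∈ V, ContDiffAt ℝ 2 φ x :=
    fun x hx => hφ.contDiffOn.contDiffAt (hφ.isOpen.mem_nhds hx)
  -- With the normal frozen at `x`, the support inequality says that the height of `φ y` in that
  -- direction is largest at `y = x`. This yields both orthogonality of `ν` and semidefiniteness of
  -- the second fundamental form `h`.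
  have hmax : ∀ x ∈ V, IsLocalMax (fun y => inner ℝ (ν x) (φ y)) x := by
    intro x hx
    filter_upwards [hφ.isOpen.mem_nhds hx] with y hy
    have := hsupp _ (hM x hx) _ (hM y hy)
    rw [inner_sub_right] at this
    exact sub_nonpos.1 this
  have hcond := fun x hx => inner_fderiv_eq_zero_and_inner_fderiv_fderiv_nonpos (hat x hx)
    (hmax x hx)
  refine ⟨gaussTensor φ ν, isCurvatureTensor_gaussTensor hφ.isOpen hφ.contDiffOn hφ.immersion
    (hNc.comp hφ.contDiffOn.continuousOn hM) (fun x hx => hN _ (hM x hx))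
    (fun x hx v => (hcond x hx v).1), fun x hx v w _ => ?_⟩
  rw [sectionalCurvature, sum_gaussTensor]
  refine div_nonneg ?_ ?_
  · have hsymm : secondForm φ ν x w v = secondForm φ ν x v w := by
      rw [secondForm, secondForm, (hat x hx).isSymmSndFDerivAt (by simp) w v]
    -- The quadratic in `t` is `-h(v + t w, v + t w)`; its discriminant being nonpositive means
    -- `h(v,w)² ≤ h(v,v) h(w,w)`, the numerator bound.
    have hquad : ∀ t : ℝ, 0 ≤ -secondForm φ ν x w w * (t * t) +
        (-2 * secondForm φ ν x v w) * t + -secondForm φ ν x v v := by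
      intro t
      have h := (hcond x hx (v + t • w)).2
      have e : inner ℝ (ν x) (fderiv ℝ (fderiv ℝ φ) x (v + t • w) (v + t • w)) =
          secondForm φ ν x v v + t * secondForm φ ν x v w +
            (t * secondForm φ ν x w v + t * (t * secondForm φ ν x w w)) := by
        simp only [secondForm, map_add, map_smul, _root_.add_apply, _root_.smul_apply,
          inner_add_right, inner_smul_right]
        ring
      rw [e, hsymm] at h
      linarith
    have := discrim_le_zero hquad
    rw [discrim] at this
    rw [hsymm]
    nlinarith
  · simp only [metricPairing_inducedMetric]
    have := real_inner_mul_inner_self_le (fderiv ℝ φ x v) (fderiv ℝ φ x w)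
    rw [pow_two]
    linarith

end

/-! ### Concave defining functions for convex sets. -/

section Graph

variable {E : Type*} [NormedAddCommGroup E] [InnerProductSpace ℝ E]

theorem concaveOn_le_add_fderiv {f : E → ℝ} {s : Set E} (hf : ConcaveOn ℝ s f) {x y : E}
    (hx : x ∈ s) (hy : y ∈ s) (hd : DifferentiableAt ℝ f x) :
    f y ≤ f x + fderiv ℝ f x (y - x) := by
  have h1 := (hd.hasFDerivAt.hasLineDerivAt (y - x)).tendsto_slope_zero_right
  suffices f y - f x ≤ fderiv ℝ f x (y - x) by linarith
  refine ge_of_tendsto h1 ?_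
  filter_upwards [Ioc_mem_nhdsGT zero_lt_one] with t ht
  have h2 := hf.2 hx hy (sub_nonneg.2 ht.2) ht.1.le (by ring)
  have e : (1 - t) • x + t • y = x + t • (y - x) := by
    rw [smul_sub, sub_smul, one_smul]; abel
  rw [e] at h2
  simp only [smul_eq_mul] at h2 ⊢
  rw [inv_mul_eq_div, le_div_iff₀ ht.1]
  linarith

/-- Near a regular zero, the sign of a `C^k` function is that of a `C^k` function `f` whose
zero set is a graph over the hyperplane orthogonal to a unit vector `e`. -/
theorem exists_graph_function [CompleteSpace E] {k : WithTop ℕ∞} (hk : k ≠ 0) (hk' : k ≠ ∞)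
    {f₀ : E → ℝ} {p : E} (hf₀ : ContDiffAt ℝ k f₀ p) (hp : f₀ p = 0) (hreg : fderiv ℝ f₀ p ≠ 0) :
    ∃ (e : E) (f : E → ℝ), ‖e‖ = 1 ∧ (∀ x (t : ℝ), f (x + t • e) = f x + t) ∧
      ContDiffAt ℝ k f p ∧ f p = 0 ∧ ∀ᶠ x in 𝓝 p, ∃ c > 0, f₀ x = c * f x := by
  obtain ⟨e, he, hpos⟩ : ∃ e : E, ‖e‖ = 1 ∧ 0 < fderiv ℝ f₀ p e := by
    obtain ⟨v, hv⟩ : ∃ v, fderiv ℝ f₀ p v ≠ 0 := by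
      by_contra! h
      exact hreg (ContinuousLinearMap.ext h)
    obtain ⟨v, hv⟩ : ∃ v, 0 < fderiv ℝ f₀ p v := by
      rcases hv.lt_or_gt with h | h
      · exact ⟨-v, by simpa using h⟩
      · exact ⟨v, h⟩
    have hv0 : v ≠ 0 := by rintro rfl; simp at hv
    refine ⟨‖v‖⁻¹ • v, by simp [norm_smul, hv0], ?_⟩
    rw [map_smul, smul_eq_mul]
    positivity
  -- `P` projects onto the hyperplane `e^⊥`. The implicit function `T` below describes the zero set
  -- of `f₀` near `p` as the graph `⟨e, x⟩ = T (P x)`. Since `P` ignores translation along `e`, the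
  -- relation for `f (x + t • e)` holds everywhere.
  set P : E → E := fun x => x - (inner ℝ e x : ℝ) • e with hP
  have hPe : ∀ x, P x + (inner ℝ e x : ℝ) • e = x := fun x => sub_add_cancel _ _
  have hPt : ∀ x (t : ℝ), P (x + t • e) = P x := by
    intro x t
    simp only [hP, inner_add_right, inner_smul_right, real_inner_self_eq_norm_sq, he]
    module
  have hPc : ContDiff ℝ k P := contDiff_id.sub ((contDiff_const.inner ℝ contDiff_id).smul
    contDiff_const)
  set G : E × ℝ → ℝ := fun q => f₀ (q.1 + q.2 • e) with hG
  set u : E × ℝ := (P p, inner ℝ e p) with hu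
  have hup : u.1 + u.2 • e = p := hPe p
  let A : E × ℝ →L[ℝ] E := ContinuousLinearMap.fst ℝ E ℝ +
    (ContinuousLinearMap.snd ℝ E ℝ).smulRight e
  have hA : ∀ q, A q = q.1 + q.2 • e := fun q => rfl
  have hGA : G = f₀ ∘ A := rfl
  have hGc : ContDiffAt ℝ k G u := by
    rw [hGA]
    exact ContDiffAt.comp u (by rwa [hA, hup]) A.contDiff.contDiffAt
  have hGd : fderiv ℝ G u = (fderiv ℝ f₀ p).comp A := by
    have h1 : HasFDerivAt f₀ (fderiv ℝ f₀ p) (A u) := by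
      rw [hA, hup]; exact (hf₀.differentiableAt hk).hasFDerivAt
    exact (h1.comp u A.hasFDerivAt).fderiv
  have hinv : (fderiv ℝ G u ∘L .inr ℝ E ℝ).IsInvertible := by
    refine ⟨ContinuousLinearEquiv.unitsEquivAut ℝ (Units.mk0 _ hpos.ne'), ?_⟩
    ext
    simp [hGd, A]
  set T := hGc.implicitFunction hk hinv with hT
  set f : E → ℝ := fun x => inner ℝ e x - T (P x) with hf
  have hTc : ContDiffAt ℝ k T (P p) := hGc.contDiffAt_implicitFunction hk hinv
  have hfc : ContDiffAt ℝ k f p := (contDiffAt_const.inner ℝ contDiffAt_id).sub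
    (ContDiffAt.comp p hTc hPc.contDiffAt)
  have hft : ∀ x (t : ℝ), f (x + t • e) = f x + t := by
    intro x t
    simp only [hf, hPt, inner_add_right, inner_smul_right, real_inner_self_eq_norm_sq, he]
    ring
  have hfp : f p = 0 := by
    have : T (P p) = inner ℝ e p := hGc.implicitFunction_apply_self hk hinv
    simp [hf, this]
  have hzero : ∀ᶠ x in 𝓝 p, f₀ (x + (-f x) • e) = 0 := by
    have h1 := (hPc.continuous.continuousAt (x := p)).eventually
      (hGc.eventually_apply_implicitFunction hk hinv)
    filter_upwards [h1] with x hx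
    have hx' : f₀ (P x + T (P x) • e) = f₀ (u.1 + u.2 • e) := hx
    rw [hup, hp] at hx'
    rw [← hx']
    congr 1
    simp only [hf, hP]
    module
  refine ⟨e, f, he, hft, hfc, hfp, ?_⟩
  have hball : ∀ᶠ x in 𝓝 p, DifferentiableAt ℝ f₀ x ∧ 0 < fderiv ℝ f₀ x e := by
    have h1 : ∀ᶠ x in 𝓝 p, DifferentiableAt ℝ f₀ x := by
      filter_upwards [hf₀.eventually hk'] with x hx using hx.differentiableAt hk
    have h2 : ContinuousAt (fun x => fderiv ℝ f₀ x e) p :=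
      (hf₀.continuousAt_fderiv hk).clm_apply continuousAt_const
    exact h1.and (h2.eventually (lt_mem_nhds hpos))
  obtain ⟨δ, hδ, hδ'⟩ := Metric.eventually_nhds_iff_ball.1 hball
  have hc : ContinuousAt (fun x => x + (-f x) • e) p :=
    continuousAt_id.add (hfc.continuousAt.neg.smul continuousAt_const)
  have hc' : ∀ᶠ x in 𝓝 p, x + (-f x) • e ∈ Metric.ball p δ :=
    hc.eventually_mem (by simpa [hfp] using Metric.ball_mem_nhds p hδ)
  filter_upwards [hzero, hc', Metric.ball_mem_nhds p hδ] with x h0 h1 h2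
  -- Mean value theorem on the segment from the foot `x - f(x) e`, where `f₀` vanishes, to `x`: the
  -- factor `c` is the positive derivative of `f₀` along `e` at an intermediate point.
  obtain ⟨z, hz, hz'⟩ := domain_mvt (f := f₀) (f' := fderiv ℝ f₀)
    (fun y hy => (hδ' y hy).1.hasFDerivAt.hasFDerivWithinAt) (convex_ball p δ) h1 h2
  refine ⟨fderiv ℝ f₀ z e, (hδ' z ((convex_ball p δ).segment_subset h1 h2 hz)).2, ?_⟩
  have e1 : x - (x + (-f x) • e) = f x • e := by module
  rw [h0, sub_zero, e1, map_smul, smul_eq_mul] at hz'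
  rw [hz', mul_comm]

/-- If `K` is convex and is given near `p` as the supergraph `{f ≥ 0}`, then `f` is concave
near `p`. -/
theorem eventually_concaveOn_ball {K : Set E} (hK : Convex ℝ K) {f : E → ℝ} {p e : E}
    (hft : ∀ x (t : ℝ), f (x + t • e) = f x + t) (hfc : ContinuousAt f p) (hfp : f p = 0)
    (hfK : ∀ᶠ x in 𝓝 p, x ∈ K ↔ 0 ≤ f x) :
    ∃ δ > 0, ConcaveOn ℝ (Metric.ball p δ) f := by
  obtain ⟨r, hr, hr'⟩ := Metric.eventually_nhds_iff_ball.1 hfK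
  have hc : ContinuousAt (fun x => x + (-f x) • e) p :=
    continuousAt_id.add (hfc.neg.smul continuousAt_const)
  have hc' : ∀ᶠ x in 𝓝 p, x + (-f x) • e ∈ Metric.ball p r :=
    hc.eventually_mem (by simpa [hfp] using Metric.ball_mem_nhds p hr)
  obtain ⟨δ, hδ, hδ'⟩ := Metric.eventually_nhds_iff_ball.1 hc'
  refine ⟨δ, hδ, convex_ball p δ, fun x hx y hy a b ha hb hab => ?_⟩
  -- The foot of `z` has `f = 0` and so lies in `K`. A convex combination of feet is again in `K`,
  -- and `f ≥ 0` there is exactly the concavity inequality.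
  have hmem : ∀ z ∈ Metric.ball p δ, z + (-f z) • e ∈ K := fun z hz =>
    (hr' _ (hδ' z hz)).2 (by rw [hft]; simp)
  have h1 := hK (hmem x hx) (hmem y hy) ha hb hab
  have h2 := (convex_ball p r) (hδ' x hx) (hδ' y hy) ha hb hab
  have h3 := (hr' _ h2).1 h1
  have e1 : a • (x + (-f x) • e) + b • (y + (-f y) • e) =
      (a • x + b • y) + (-(a * f x + b * f y)) • e := by module
  rw [e1, hft] at h3
  simp only [smul_eq_mul]
  linarith

end Graph

/-! ### The fold as a hypersurface with supporting hyperplanes. -/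

section Fold

variable {n : ℕ} {U : Set (Plane n)} {f : Plane n → ℝ} {e : Plane n} {lam : ℝ}

theorem fderiv_apply_eq_one_of_translate {E : Type*} [NormedAddCommGroup E] [NormedSpace ℝ E]
    {f : E → ℝ} {e x : E} (hft : ∀ x (t : ℝ), f (x + t • e) = f x + t)
    (hd : DifferentiableAt ℝ f x) : fderiv ℝ f x e = 1 := by
  have h1 : HasDerivAt (fun t : ℝ => f (x + t • e)) (fderiv ℝ f x e) 0 :=
    hd.hasFDerivAt.hasLineDerivAt e
  have h2 : HasDerivAt (fun t : ℝ => f (x + t • e)) 1 0 := by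
    simp only [hft]
    exact (hasDerivAt_id (0 : ℝ)).const_add (f x)
  exact h1.unique h2

/-- Parameters of `foldMap` may lie outside `U`; they are translates along `e` of points of `U`, and
smoothness of `f` is carried to them. -/
theorem contDiffAt_translate {E : Type*} [NormedAddCommGroup E] [NormedSpace ℝ E]
    {k : WithTop ℕ∞} {f : E → ℝ} {e x : E} (hft : ∀ x (t : ℝ), f (x + t • e) = f x + t)
    (t : ℝ) (hf : ContDiffAt ℝ k f (x + t • e)) : ContDiffAt ℝ k f x := by
  have h1 : ContDiffAt ℝ k (fun y => f (y + t • e)) x :=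
    ContDiffAt.comp x hf (contDiffAt_id.add contDiffAt_const)
  have h2 : f = fun y => f (y + t • e) - t := by
    ext y
    rw [hft, add_sub_cancel_right]
  rw [h2]
  exact h1.sub contDiffAt_const

/-- The parametrization of the fold over the hyperplane spanned by `e^⊥` and the `z`-axis, which
is identified with `ℝⁿ` by letting `e` correspond to the `z`-axis. -/
def foldMap (f : Plane n → ℝ) (e : Plane n) (lam : ℝ) (y : Plane n) : Ambient n :=
  WithLp.toLp 2 (y + ((inner ℝ e y : ℝ) ^ 2 / lam ^ 2 - f y) • e, inner ℝ e y)

/-- The linear left inverse of `foldMap`. -/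
def foldInv (e : Plane n) (q : Ambient n) : Plane n :=
  q.fst + (q.snd - inner ℝ e q.fst) • e

theorem contDiff_foldInv (e : Plane n) : ContDiff ℝ 2 (foldInv e) := by
  have h1 : ContDiff ℝ 2 fun q : Ambient n => q.fst :=
    (WithLp.fstL 2 ℝ (EuclideanSpace ℝ (Fin n)) ℝ).contDiff
  have h2 : ContDiff ℝ 2 fun q : Ambient n => q.snd :=
    (WithLp.sndL 2 ℝ (EuclideanSpace ℝ (Fin n)) ℝ).contDiff
  exact h1.add ((h2.sub (contDiff_const.inner ℝ h1)).smul contDiff_const)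

theorem foldInv_foldMap (he : ‖e‖ = 1) (y : Plane n) : foldInv e (foldMap f e lam y) = y := by
  simp only [foldInv, foldMap, WithLp.toLp_fst, WithLp.toLp_snd, inner_add_right, inner_smul_right,
    real_inner_self_eq_norm_sq, he]
  module

theorem contDiffAt_foldMap {y : Plane n} (hf : ContDiffAt ℝ 2 f y) :
    ContDiffAt ℝ 2 (foldMap f e lam) y := by
  have h1 : ContDiffAt ℝ 2 (fun y : Plane n => (inner ℝ e y : ℝ)) y :=
    contDiffAt_const.inner ℝ contDiffAt_id
  have h2 : ContDiffAt ℝ 2 (fun y : Plane n =>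
      (y + ((inner ℝ e y : ℝ) ^ 2 / lam ^ 2 - f y) • e, (inner ℝ e y : ℝ))) y :=
    (contDiffAt_id.add ((((h1.pow 2).div_const _).sub hf).smul contDiffAt_const)).prodMk h1
  exact (WithLp.prodContinuousLinearEquiv 2 ℝ (EuclideanSpace ℝ (Fin n)) ℝ).symm.contDiff.contDiffAt.comp
    y h2

/-- Solving `z² = lam² f(x)` for `z` fails to be smooth along `z = 0`, but solving for the
`e`-coordinate of `x` always works, because `f` is affine along `e` with slope 1. A single chart
covers the whole fold. -/
theorem isC2Hypersurface_fold (hU : IsOpen U) (he : ‖e‖ = 1) (hlam : lam ≠ 0)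
    (hft : ∀ x (t : ℝ), f (x + t • e) = f x + t) (hf : ∀ x ∈ U, ContDiffAt ℝ 2 f x) :
    IsC2Hypersurface (fold U f lam) := by
  set φ := foldMap f e lam with hφ
  set D : Set (Plane n) := {y | ContDiffAt ℝ 2 f y} with hD
  have hDo : IsOpen D := isOpen_iff_eventually.2 fun y hy =>
    (show ContDiffAt ℝ 2 f y from hy).eventually (by simp)
  have hDφ : ∀ y ∈ D, ContDiffAt ℝ 2 φ y := fun y hy => contDiffAt_foldMap hy
  have hfst : ContinuousOn (fun y => (φ y).fst) D := fun y hy =>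
    ((WithLp.fstL 2 ℝ (EuclideanSpace ℝ (Fin n)) ℝ).continuous.continuousAt.comp
      (hDφ y hy).continuousAt).continuousWithinAt
  set V : Set (Plane n) := D ∩ (fun y => (φ y).fst) ⁻¹' U with hV
  have hinv : Function.LeftInverse (foldInv e) φ := foldInv_foldMap he
  have himage : φ '' V = fold U f lam := by
    ext q
    constructor
    · rintro ⟨y, ⟨-, hy⟩, rfl⟩
      refine ⟨hy, ?_⟩
      -- The translation rule cancels `f y`, leaving `f(x) = z² / lam²` with `z = ⟨e, y⟩`.
      simp only [hφ, foldMap, WithLp.toLp_fst, WithLp.toLp_snd, hft]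
      field_simp
      ring
    · rintro ⟨hqU, hq⟩
      have hfq : f (foldInv e q) = f q.fst + (q.snd - inner ℝ e q.fst) := hft _ _
      have hq' : φ (foldInv e q) = q := by
        have h1 : (inner ℝ e (foldInv e q) : ℝ) = q.snd := by
          simp only [foldInv, inner_add_right, inner_smul_right, real_inner_self_eq_norm_sq, he]
          ring
        have h2 : (φ (foldInv e q)).fst = q.fst := by
          simp only [hφ, foldMap, WithLp.toLp_fst, h1, hfq]
          rw [hq, mul_div_cancel_left₀ _ (pow_ne_zero 2 hlam), foldInv]
          module
        exact (WithLp.ofLp_injective 2) (Prod.ext h2 h1)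
      refine ⟨foldInv e q, ⟨?_, ?_⟩, hq'⟩
      · change ContDiffAt ℝ 2 f _
        refine contDiffAt_translate hft (-(q.snd - inner ℝ e q.fst)) ?_
        have : foldInv e q + (-(q.snd - inner ℝ e q.fst)) • e = q.fst := by
          rw [foldInv]; module
        rw [this]
        exact hf _ hqU
      · change (φ (foldInv e q)).fst ∈ U
        rwa [hq']
  have hdiff : ∀ y ∈ V, DifferentiableAt ℝ φ y := fun y hy =>
    (hDφ y hy.1).differentiableAt (by simp)
  intro q hq
  refine ⟨V, φ, ⟨hfst.isOpen_inter_preimage hDo hU,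
    fun y hy => (hDφ y hy.1).contDiffWithinAt, fun y hy => ?_, ?_, Set.univ, isOpen_univ, ?_⟩, ?_⟩
  -- Differentiating `foldInv e ∘ φ = id` gives a left inverse of the derivative of `φ`.
  · have h1 : HasFDerivAt (foldInv e ∘ φ)
        ((fderiv ℝ (foldInv e) (φ y)).comp (fderiv ℝ φ y)) y :=
      (((contDiff_foldInv e).differentiable (by simp)) _).hasFDerivAt.comp y
        (hdiff y hy).hasFDerivAt
    rw [hinv.comp_eq_id] at h1
    have h2 := h1.unique (hasFDerivAt_id y)
    exact Function.LeftInverse.injective (g := fderiv ℝ (foldInv e) (φ y)) fun v =>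
      congrArg (fun A : Plane n →L[ℝ] Plane n => A v) h2
  · refine Topology.IsEmbedding.of_comp (g := foldInv e) ?_ (contDiff_foldInv e).continuous ?_
    · exact continuousOn_iff_continuous_domRestrict.1 fun y hy =>
        (hDφ y hy.1).continuousAt.continuousWithinAt
    · have : foldInv e ∘ (fun y : V => φ y) = Subtype.val := funext fun y => hinv y
      rw [this]
      exact Topology.IsEmbedding.subtypeVal
  · rw [himage, Set.inter_univ]
  · rwa [himage]

/-- The gradient of `z² - lam² f(x)` at `q = (x, z)`. -/
def foldGradient (f : Plane n → ℝ) (lam : ℝ) (q : Ambient n) : Ambient n :=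
  WithLp.toLp 2 (-lam ^ 2 • gradient f q.fst, 2 * q.snd)

theorem inner_foldGradient (q v : Ambient n) :
    inner ℝ (foldGradient f lam q) v =
      -lam ^ 2 * fderiv ℝ f q.fst v.fst + 2 * q.snd * v.snd := by
  rw [WithLp.prod_inner_apply]
  simp only [foldGradient]
  rw [inner_smul_left, inner_gradient_left]
  simp [mul_comm]

theorem sectionalCurvatureGE_fold (hlam : lam ≠ 0)
    (hft : ∀ x (t : ℝ), f (x + t • e) = f x + t) (hf : ∀ x ∈ U, ContDiffAt ℝ 2 f x)
    (hconc : ConcaveOn ℝ U f) : SectionalCurvatureGE (fold U f lam) 0 := by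
  have hne : ∀ q ∈ fold U f lam, foldGradient f lam q ≠ 0 := by
    intro q hq h
    -- Paired with `(e, 0)`, the gradient gives `-lam²`, so it cannot vanish, even where `z = 0`.
    have h1 := inner_foldGradient (f := f) (lam := lam) q (WithLp.toLp 2 (e, 0))
    rw [h, inner_zero_left] at h1
    have h2 := fderiv_apply_eq_one_of_translate hft ((hf _ hq.1).differentiableAt (by simp))
    simp only [WithLp.toLp_fst, WithLp.toLp_snd, h2] at h1
    simp [hlam] at h1
  have hcont : ContinuousOn (foldGradient f lam) (fold U f lam) := by
    have hfst : Continuous fun q : Ambient n => q.fst :=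
      (WithLp.fstL 2 ℝ (EuclideanSpace ℝ (Fin n)) ℝ).continuous
    have hsnd : Continuous fun q : Ambient n => q.snd :=
      (WithLp.sndL 2 ℝ (EuclideanSpace ℝ (Fin n)) ℝ).continuous
    intro q hq
    refine ContinuousAt.continuousWithinAt ?_
    have h1 : ContinuousAt (gradient f) q.fst :=
      (InnerProductSpace.toDual ℝ (Plane n)).symm.continuous.continuousAt.comp
        ((hf _ hq.1).continuousAt_fderiv (by simp))
    have h2 : ContinuousAt (fun q : Ambient n => gradient f q.fst) q :=
      ContinuousAt.comp (f := fun q : Ambient n => q.fst) h1 hfst.continuousAt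
    have h3 : ContinuousAt (fun q : Ambient n => (-lam ^ 2 • gradient f q.fst, 2 * q.snd)) q :=
      (h2.const_smul (-lam ^ 2)).prodMk (hsnd.continuousAt.const_mul 2)
    exact (WithLp.prodContinuousLinearEquiv 2 ℝ (EuclideanSpace ℝ (Fin n))
      ℝ).symm.continuous.continuousAt.comp h3
  refine sectionalCurvatureGE_zero_of_support
    (N := fun q => ‖foldGradient f lam q‖⁻¹ • foldGradient f lam q)
    ((hcont.norm.inv₀ fun q hq => norm_ne_zero_iff.2 (hne q hq)).smul hcont)
    (fun q hq => ?_) fun q hq q' hq' => ?_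
  · simp [norm_smul, hne q hq]
  · rw [real_inner_smul_left]
    refine mul_nonpos_of_nonneg_of_nonpos (by positivity) ?_
    rw [inner_foldGradient]
    have h1 := concaveOn_le_add_fderiv hconc hq.1 hq'.1 ((hf _ hq.1).differentiableAt (by simp))
    have h2 := hq.2
    have h3 := hq'.2
    have h4 : (q' - q).fst = q'.fst - q.fst := rfl
    have h5 : (q' - q).snd = q'.snd - q.snd := rfl
    rw [h4, h5]
    have h6 := mul_le_mul_of_nonneg_left h1 (sq_nonneg lam)
    -- The tangent inequality for `f` and the two fold equations bound the pairing by `-(z' - z)²`.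
    nlinarith [sq_nonneg (q'.snd - q.snd)]

end Fold

end FoldBilliard

end

/-! ### Assembly of the theorem. -/

theorem mainTheorem4 (n : ℕ) (K : Set (FoldBilliard.Plane n))
    (hK : FoldBilliard.IsBilliardTable K) (hconv : Convex ℝ K)
    (p₀ : FoldBilliard.Plane n) (hp₀ : p₀ ∈ frontier K) :
    ∃ (U : Set (FoldBilliard.Plane n)) (f : FoldBilliard.Plane n → ℝ),
      IsOpen U ∧ Bornology.IsBounded U ∧ p₀ ∈ U ∧ FoldBilliard.IsDefiningFunction K U f ∧
      ∀ lam ∈ Set.Ioo (0 : ℝ) 1,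
        FoldBilliard.IsC2Hypersurface (FoldBilliard.fold U f lam) ∧
        FoldBilliard.SectionalCurvatureGE (FoldBilliard.fold U f lam) 0 := by
  obtain ⟨U₀, f₀, hU₀, -, hpU₀, hf₀⟩ := hK.boundary p₀ hp₀
  have hp0 : f₀ p₀ = 0 := (hf₀.boundary.subset ⟨hp₀, hpU₀⟩).2
  have hc0 : ContDiffAt ℝ 2 f₀ p₀ :=
    (hf₀.contDiffOn.mono subset_closure).contDiffAt (hU₀.mem_nhds hpU₀)
  obtain ⟨e, f, he, hft, hfc, hfp, hsign⟩ := FoldBilliard.exists_graph_function (by simp)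
    (by simp) hc0 hp0 (hf₀.regular p₀ hpU₀ hp0)
  have hloc : ∀ᶠ x in nhds p₀, (x ∈ K ↔ 0 ≤ f x) ∧ (x ∈ frontier K ↔ f x = 0) ∧
      ContDiffAt ℝ 2 f x := by
    filter_upwards [hsign, hU₀.mem_nhds hpU₀, hfc.eventually (by simp)] with x ⟨c, hc, hx⟩ hxU hxc
    have h1 : x ∈ K ↔ 0 ≤ f₀ x :=
      ⟨fun h => (hf₀.table.subset ⟨h, hxU⟩).2, fun h => (hf₀.table.superset ⟨hxU, h⟩).1⟩
    have h2 : x ∈ frontier K ↔ f₀ x = 0 :=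
      ⟨fun h => (hf₀.boundary.subset ⟨h, hxU⟩).2, fun h => (hf₀.boundary.superset ⟨hxU, h⟩).1⟩
    rw [h1, h2, hx, mul_nonneg_iff_of_pos_left hc, mul_eq_zero_iff_left hc.ne']
    exact ⟨Iff.rfl, Iff.rfl, hxc⟩
  obtain ⟨δ, hδ, hconc⟩ := FoldBilliard.eventually_concaveOn_ball hconv hft hfc.continuousAt hfp
    (hloc.mono fun x hx => hx.1)
  -- A closed ball is used so that `f` is `C²` on the closure of the final neighborhood; `δ` takes
  -- care of concavity.
  obtain ⟨r, hr, hr'⟩ := Metric.nhds_basis_closedBall.eventually_iff.1 hloc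
  set ρ := min δ r with hρ
  have hρ0 : 0 < ρ := lt_min hδ hr
  have hsub : ∀ x ∈ Metric.ball p₀ ρ, x ∈ Metric.closedBall p₀ r := fun x hx =>
    Metric.closedBall_subset_closedBall (min_le_right _ _) (Metric.ball_subset_closedBall hx)
  have hU : ∀ x ∈ Metric.ball p₀ ρ, ContDiffAt ℝ 2 f x := fun x hx => (hr' (hsub x hx)).2.2
  refine ⟨Metric.ball p₀ ρ, f, Metric.isOpen_ball, Metric.isBounded_ball,
    Metric.mem_ball_self hρ0, ⟨fun x hx => ?_, fun x hx _ h => ?_, ?_, ?_⟩, fun lam hlam =>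
    ⟨FoldBilliard.isC2Hypersurface_fold Metric.isOpen_ball he hlam.1.ne' hft hU,
      FoldBilliard.sectionalCurvatureGE_fold hlam.1.ne' hft hU
        (hconc.subset (Metric.ball_subset_ball (min_le_left _ _)) (convex_ball _ _))⟩⟩
  · exact (hr' (Metric.closedBall_subset_closedBall (min_le_right _ _)
      (Metric.closure_ball_subset_closedBall hx))).2.2.contDiffWithinAt
  · have := FoldBilliard.fderiv_apply_eq_one_of_translate hft
      ((hU x hx).differentiableAt (by simp))
    simp [h] at this
  · ext x
    exact ⟨fun h => ⟨h.2, (hr' (hsub x h.2)).1.1 h.1⟩, fun h => ⟨(hr' (hsub x h.1)).1.2 h.2, h.1⟩⟩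
  · ext x
    exact ⟨fun h => ⟨h.2, (hr' (hsub x h.2)).2.1.1 h.1⟩,
      fun h => ⟨(hr' (hsub x h.1)).2.1.2 h.2, h.1⟩⟩
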